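/- Call \emph{weight function} any continuous non-decreasing function $w:[0,\infty)\to(0,\infty)$. For a weight function $w$ such that $W(x):=\int_0^x \frac{du}{w(u)}$ tends to $+\infty$ as $x\to\infty$, let $W^{-1}$ be the inverse of the bijection $W:[0,\infty)\to[0,\infty)$; for a measurable $f:[0,\infty)\to[0,\infty)$ set $$G(f)(x):=\int_0^x\frac{w(W^{-1}(f(u)))}{w(W^{-1}(u))}\,du ,$$ and for $\eta\in(0,1)$ define, with $G^{(n)}$ the $n$-fold iterate of $G$, $\mathrm{Id}$ the identity function and $\inf\emptyset=+\infty$, $$i_\eta(w):=\inf\{n\ge 2 : G^{(n-1)}(\eta\,\mathrm{Id})\text{ is bounded}\},\qquad i_\pm(w):=\lim_{\eta\to\frac12^\pm} i_\eta(w).$$ The vertex reinforced random walk (VRRW) on $\mathbb Z$ with weight $w$ is the process $(X_n)_{n\ge0}$ with $X_0=0$ which, given $X_0,\dots,X_n$, jumps to $X_n\pm1$ with probabilities $$\frac{w(Z_n(X_n\pm1))}{w(Z_n(X_n-1))+w(Z_n(X_n+1))},\qquad Z_n(y):=\#\{0\le i\le n : X_i=y\}.$$ It localizes if the set of sites it visits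 is finite. Let $\tilde w$ be a weight function such that $\tilde w(x)=x\exp\left(-\frac{\log x}{\log\log x}\right)$ for all sufficiently large $x$. Then: (1) $i_-(\tilde w)=i_+(\tilde w)=+\infty$; (2) almost surely, the VRRW with weight $\tilde w$ does not localize; (3) for every $\alpha<1$, $\tilde w(x)=o\left(\frac{x}{\exp((\log x)^\alpha)}\right)$ as $x\to\infty$. -/

import Mathlib

open Real Set Filter Topology MeasureTheory ProbabilityTheory Asymptotics

namespace VRRW

/-- A weight function: a continuous, non-decreasing function `[0,∞) → (0,∞)`.
Only the values on `[0,∞)` of the total function `w : ℝ → ℝ` matter. -/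
structure IsWeightFunction (w : ℝ → ℝ) : Prop where
  continuousOn : ContinuousOn w (Ici 0)
  monotoneOn : MonotoneOn w (Ici 0)
  pos : ∀ x, 0 ≤ x → 0 < w x

/-- The primitive `W(x) = ∫₀ˣ du / w(u)`, for `x ≥ 0`. -/
noncomputable def W (w : ℝ → ℝ) (x : ℝ) : ℝ :=
  ∫ u in (0 : ℝ)..x, 1 / w u

/-- The inverse `W⁻¹ : [0,∞) → [0,∞)` of `W`. For a weight function `w`, `W` is strictly increasing
and continuous on `[0,∞)` with `W(0) = 0`, so it is a bijection of `[0,∞)` as soon as it is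
unbounded, as is the case when `w(x) ≤ x` for large `x`. -/
noncomputable def Winv (w : ℝ → ℝ) : ℝ → ℝ :=
  Function.invFunOn (W w) (Ici 0)

/-- The operator `G(f)(x) = ∫₀ˣ w(W⁻¹(f(u))) / w(W⁻¹(u)) du`. -/
noncomputable def G (w : ℝ → ℝ) (f : ℝ → ℝ) (x : ℝ) : ℝ :=
  ∫ u in (0 : ℝ)..x, w (Winv w (f u)) / w (Winv w u)

/-- The index `i_η(w) = inf {n ≥ 2 : G^(n-1)(η Id) is bounded on [0,∞)}`, with `inf ∅ = ∞`. -/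
noncomputable def index (w : ℝ → ℝ) (η : ℝ) : ℕ∞ :=
  sInf ((fun n : ℕ => (n : ℕ∞)) ''
    {n : ℕ | 2 ≤ n ∧ ∃ C : ℝ, ∀ x, 0 ≤ x → |((G w)^[n - 1] (fun u => η * u)) x| ≤ C})

/-- `visits x n y` is the number of visits of the path `x` to the site `y` up to time `n`
(times `0` and `n` included). -/
def visits (x : ℕ → ℤ) (n : ℕ) (y : ℤ) : ℕ :=
  ((Finset.range (n + 1)).filter fun i => x i = y).card

/-- The event that `X` follows the path `x` up to time `n`. -/
def history {Ω : Type*} (X : ℕ → Ω → ℤ) (x : ℕ → ℤ) (n : ℕ) : Set Ω :=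
  {ω | ∀ i ≤ n, X i ω = x i}

/-- `X` is, under `μ`, a vertex reinforced random walk on `ℤ` started from `0` with weight
sequence `w`: given its past up to time `n`, it jumps to one of the two neighbours of its current
position, with probabilities proportional to the weights `w` of their numbers of visits. -/
structure IsVRRW {Ω : Type*} [MeasurableSpace Ω] (w : ℕ → ℝ) (X : ℕ → Ω → ℤ)
    (μ : Measure Ω) : Prop where
  measurable : ∀ n, Measurable (X n)
  start : ∀ᵐ ω ∂μ, X 0 ω = 0
  left : ∀ (n : ℕ) (x : ℕ → ℤ), μ (history X x n) ≠ 0 →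
    μ[{ω | X (n + 1) ω = x n - 1} | history X x n] =
      ENNReal.ofReal (w (visits x n (x n - 1)) /
        (w (visits x n (x n - 1)) + w (visits x n (x n + 1))))
  right : ∀ (n : ℕ) (x : ℕ → ℤ), μ (history X x n) ≠ 0 →
    μ[{ω | X (n + 1) ω = x n + 1} | history X x n] =
      ENNReal.ofReal (w (visits x n (x n + 1)) /
        (w (visits x n (x n - 1)) + w (visits x n (x n + 1))))

/-- A path localizes if its range is finite. -/
def Localizes (x : ℕ → ℤ) : Prop := (Set.range x).Finite

end VRRW

/-!
The weight enters only through one estimate: the logarithmic slope of `w` between large arguments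
stays below `1` by more than any negative power of the logarithm. For `w x = x exp (-φ (log x))`
with `φ t = t / log t` this holds because the slope of `φ` is about `1 / log t`. Integrating
the estimate, `x / w x` dominates `exp ((log x) ^ α)` for every `α < 1`, while `W x` exceeds
`x / w x` by at most a factor `(log x) ^ 2`. Hence if `W p` is at least
`exp (-(log m) ^ a) * (m / w m)` for some `a < 1`, then `p` is at least `m * exp (-(log m) ^ b)`
for some `b < 1`.

Iterates of `G`: with `m = W⁻¹ x` and `p = W⁻¹ (f x)` this shows that `G` preserves the class
of functions larger than `x exp (-(log x) ^ b)` at infinity for some `b < 1`. That class contains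
`η Id` and no bounded function.

The walk: if it stays in a finite set, then along a sequence of times some site `y` carries
a positive fraction of the time `n`. Each visit to `y` at a time `k < n` is followed by a jump to
`y + 1` with probability at least `w (visits to y + 1) / (2 w n)`, so an exponential
supermartingale bounds `(visits to y) / w n` by a multiple of `W (visits to y + 1)`, up to a
constant. With `m = n` and `p` the number of visits to `y + 1`, the site `y + 1` is then visited
at least `n exp (-(log n) ^ b)` times, hence so are `y + 2`, `y + 3` and all further sites. Fatou's
lemma, applied to the sum of the supermartingales of finitely many sites, yields one sequence of
times along which all these bounds hold.
-/

namespace VRRW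

section RpowComparison

theorem eventually_const_mul_rpow_le_rpow {a b : ℝ} (hab : a < b) (C : ℝ) :
    ∀ᶠ t : ℝ in atTop, C * t ^ a ≤ t ^ b := by
  filter_upwards [(tendsto_rpow_atTop (sub_pos.2 hab)).eventually_ge_atTop C,
    eventually_gt_atTop 0] with t hC ht
  calc C * t ^ a ≤ t ^ (b - a) * t ^ a := by gcongr
    _ = t ^ b := by rw [← rpow_add ht, sub_add_cancel]

theorem tendsto_rpow_sub_const_mul_rpow_atTop {a b : ℝ} (hb : 0 < b) (hab : a < b) (C : ℝ) :
    Tendsto (fun t : ℝ => t ^ b - C * t ^ a) atTop atTop := by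
  refine tendsto_atTop_mono' _ ?_ ((tendsto_rpow_atTop hb).atTop_div_const two_pos)
  filter_upwards [eventually_const_mul_rpow_le_rpow hab (2 * C)] with t ht
  linarith

theorem eventually_const_mul_log_le_rpow {a : ℝ} (ha : 0 < a) (C : ℝ) :
    ∀ᶠ t : ℝ in atTop, C * log t ≤ t ^ a := by
  filter_upwards [((isLittleO_log_rpow_atTop ha).const_mul_left C).bound one_pos,
    eventually_ge_atTop 0] with t ht ht0
  rw [one_mul, norm_of_nonneg (rpow_nonneg ht0 a)] at ht
  exact (le_abs_self _).trans ht

theorem eventually_exp_log_rpow_le {c : ℝ} (hc : c < 1) :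
    ∀ᶠ x : ℝ in atTop, exp (log x ^ c) ≤ x := by
  filter_upwards [tendsto_log_atTop.eventually_ge_atTop 1, eventually_gt_atTop 0] with x hlog hx
  rw [← le_log_iff_exp_le hx]
  simpa using rpow_le_rpow_of_exponent_le hlog hc.le

end RpowComparison

/-! ### Slowly decaying quantities -/

/-- The quantity `r` decays, along `l`, no faster than the stretched exponential `exp (-t ^ b)` for
some `b < 1`. With `t = log x` these are the losses that the operator `G` and the comparison of
neighbouring sites inflict on a function of size `x`; an unspecified exponent `b` absorbs all
the constants and powers of logarithms along the way. -/
def SlowDecay {ι : Type*} (l : Filter ι) (t r : ι → ℝ) : Prop :=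
  ∃ b ∈ Ioo (0 : ℝ) 1, ∀ᶠ i in l, exp (-t i ^ b) ≤ r i

namespace SlowDecay

variable {ι : Type*} {l : Filter ι} {t u r r' L : ι → ℝ}

theorem mono (h : SlowDecay l t r) (hr : ∀ᶠ i in l, r i ≤ r' i) : SlowDecay l t r' := by
  obtain ⟨b, hb, hle⟩ := h
  exact ⟨b, hb, (hle.and hr).mono fun _ hi => hi.1.trans hi.2⟩

theorem eventually_pos (h : SlowDecay l t r) : ∀ᶠ i in l, 0 < r i := by
  obtain ⟨b, -, hle⟩ := h
  exact hle.mono fun _ hi => (exp_pos _).trans_le hi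

theorem min_one (h : SlowDecay l t r) (ht : Tendsto t l atTop) :
    SlowDecay l t fun i => min 1 (r i) := by
  obtain ⟨b, hb, hle⟩ := h
  refine ⟨b, hb, ?_⟩
  filter_upwards [hle, ht.eventually_ge_atTop 0] with i hi hti
  exact le_min (exp_le_one_iff.2 (neg_nonpos.2 (rpow_nonneg hti b))) hi

theorem const_mul (h : SlowDecay l t r) (ht : Tendsto t l atTop) {c : ℝ} (hc : 0 < c) :
    SlowDecay l t fun i => c * r i := by
  obtain ⟨b, ⟨hb0, hb1⟩, hle⟩ := h
  obtain ⟨b', hbb', hb'1⟩ := exists_between hb1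
  have hb'0 := hb0.trans hbb'
  refine ⟨b', ⟨hb'0, hb'1⟩, ?_⟩
  filter_upwards [hle, ((tendsto_rpow_sub_const_mul_rpow_atTop hb'0 hbb' 1).comp
    ht).eventually_ge_atTop (-log c)] with i hi hlog
  calc exp (-t i ^ b') ≤ exp (log c + -t i ^ b) := by
        simp only [Function.comp_apply, one_mul] at hlog
        gcongr
        linarith
    _ = c * exp (-t i ^ b) := by rw [exp_add, exp_log hc]
    _ ≤ c * r i := by gcongr

theorem const (ht : Tendsto t l atTop) {c : ℝ} (hc : 0 < c) : SlowDecay l t fun _ => c := by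
  have hone : SlowDecay l t fun _ => 1 := by
    refine ⟨1 / 2, by norm_num, ?_⟩
    filter_upwards [ht.eventually_ge_atTop 0] with i hti
    exact exp_le_one_iff.2 (neg_nonpos.2 (rpow_nonneg hti _))
  simpa only [mul_one] using hone.const_mul ht hc

theorem of_le_rpow (h : SlowDecay l t r) (ht : ∀ᶠ i in l, 0 ≤ t i) (hu : ∀ᶠ i in l, 0 ≤ u i)
    (htu : ∀ κ : ℝ, 1 < κ → ∀ᶠ i in l, t i ≤ u i ^ κ) : SlowDecay l u r := by
  obtain ⟨b, ⟨hb0, hb1⟩, hle⟩ := h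
  obtain ⟨b', hbb', hb'1⟩ := exists_between hb1
  refine ⟨b', ⟨hb0.trans hbb', hb'1⟩, ?_⟩
  filter_upwards [hle, ht, hu, htu (b' / b) ((one_lt_div hb0).2 hbb')] with i hi hti hui hκ
  have hpow : t i ^ b ≤ u i ^ b' := by
    calc t i ^ b ≤ (u i ^ (b' / b)) ^ b := rpow_le_rpow hti hκ hb0.le
      _ = u i ^ b' := by rw [← rpow_mul hui, div_mul_cancel₀ _ hb0.ne']
  exact (exp_le_exp.2 (neg_le_neg hpow)).trans hi

theorem tendsto_mul_atTop (h : SlowDecay l t r) (ht : Tendsto t l atTop)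
    (hL : ∀ c : ℝ, c < 1 → ∀ᶠ i in l, exp (t i ^ c) ≤ L i) :
    Tendsto (fun i => L i * r i) l atTop := by
  obtain ⟨b, ⟨hb0, hb1⟩, hle⟩ := h
  obtain ⟨c, hbc, hc1⟩ := exists_between hb1
  refine tendsto_atTop_mono' _ ?_ (tendsto_exp_atTop.comp
    ((tendsto_rpow_sub_const_mul_rpow_atTop (hb0.trans hbc) hbc 1).comp ht))
  filter_upwards [hle, hL c hc1] with i hri hLi
  have hLi0 : 0 ≤ L i := (exp_pos _).le.trans hLi
  calc exp (t i ^ c - 1 * t i ^ b) = exp (t i ^ c) * exp (-t i ^ b) := by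
        rw [one_mul, sub_eq_add_neg, exp_add]
    _ ≤ L i * r i := by gcongr

end SlowDecay

/-- The logarithmic slope `log (w y / w x) / log (y / x)` of `w` between any two large arguments
stays below `1` by at least every negative power of `log y`. Both the powers `x ^ ρ` with `ρ < 1`
and `x exp (-(log x / log (log x)))`, whose slope is about `1 - 1 / log (log x)`, have this
property, whereas `x exp (-(log x) ^ α)` with `0 < α < 1` fails it. -/
def UniformlySublinear (w : ℝ → ℝ) : Prop :=
  ∀ δ : ℝ, 0 < δ → ∀ᶠ x in atTop, ∀ y ≥ x, log (w y / w x) ≤ (1 - log y ^ (-δ)) * log (y / x)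

section LogLogWeight

theorem sub_div_two_mul_log_le_div_log_sub_div_log {s t : ℝ} (hs : exp 2 ≤ s) (hst : s ≤ t) :
    (t - s) / (2 * log t) ≤ t / log t - s / log s := by
  have hs0 : 0 < s := (exp_pos 2).trans_le hs
  have ht0 : 0 < t := hs0.trans_le hst
  have hlogs : 2 ≤ log s := (le_log_iff_exp_le hs0).2 hs
  have hlog : log s ≤ log t := log_le_log hs0 hst
  have hlogs0 : 0 < log s := by linarith
  have hlogt0 : 0 < log t := by linarith
  have hdiff : s * (log t - log s) ≤ t - s := by
    calc s * (log t - log s) = s * log (t / s) := by rw [log_div ht0.ne' hs0.ne']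
      _ ≤ s * (t / s - 1) := by gcongr; exact log_le_sub_one_of_pos (div_pos ht0 hs0)
      _ = t - s := by field_simp
  have hcross : (t - s) * log s ≤ 2 * (t * log s - s * log t) := by
    nlinarith [mul_nonneg (sub_nonneg.2 hst) (sub_nonneg.2 hlogs)]
  calc (t - s) / (2 * log t) = (t - s) * log s / (2 * log t * log s) :=
        (mul_div_mul_right _ _ hlogs0.ne').symm
    _ ≤ 2 * (t * log s - s * log t) / (2 * log t * log s) := by gcongr
    _ = t / log t - s / log s := by field_simp

theorem uniformlySublinear_of_eventually_eq_mul_exp {w : ℝ → ℝ}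
    (hw : ∀ᶠ x : ℝ in atTop, w x = x * exp (-(log x / log (log x)))) :
    UniformlySublinear w := by
  intro δ hδ
  filter_upwards [eventually_forall_ge_atTop.2 hw, eventually_gt_atTop 0,
    tendsto_log_atTop.eventually_ge_atTop (exp 2),
    eventually_forall_ge_atTop.2 (tendsto_log_atTop.eventually
      (eventually_const_mul_log_le_rpow hδ 2))] with x hwx hx hlogx hδx y hxy
  have hy : 0 < y := hx.trans_le hxy
  have hlogxy : log x ≤ log y := log_le_log hx hxy
  have hlogy0 : 0 < log y := (exp_pos 2).trans_le (hlogx.trans hlogxy)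
  have hloglogy : 2 ≤ log (log y) :=
    (le_log_iff_exp_le hlogy0).2 (hlogx.trans hlogxy)
  have hlogw : ∀ z, x ≤ z → log (w z) = log z - log z / log (log z) := fun z hz => by
    rw [hwx z hz, log_mul (hx.trans_le hz).ne' (exp_pos _).ne', log_exp, sub_eq_add_neg]
  have hwne : ∀ z, x ≤ z → w z ≠ 0 := fun z hz => by
    rw [hwx z hz]
    exact (mul_pos (hx.trans_le hz) (exp_pos _)).ne'
  have hslope : log y ^ (-δ) * (log y - log x) ≤ log y / log (log y) - log x / log (log x) := by
    refine le_trans ?_ (sub_div_two_mul_log_le_div_log_sub_div_log hlogx hlogxy)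
    rw [rpow_neg hlogy0.le, inv_mul_eq_div]
    exact div_le_div_of_nonneg_left (sub_nonneg.2 hlogxy) (by linarith) (hδx y hxy)
  rw [log_div (hwne y hxy) (hwne x le_rfl), log_div hy.ne' hx.ne', hlogw y hxy, hlogw x le_rfl]
  linarith

end LogLogWeight

/-! ### The primitive `W` and its inverse -/

section Primitive

theorem continuousOn_intervalIntegral_Ici {E : Type*} [NormedAddCommGroup E] [NormedSpace ℝ E]
    {f : ℝ → E} {a : ℝ} (hf : ContinuousOn f (Ici a)) :
    ContinuousOn (fun x => ∫ u in a..x, f u) (Ici a) := by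
  have hcont : Continuous fun u => f (max a u) :=
    hf.comp_continuous (continuous_const.max continuous_id) fun u => le_max_left a u
  refine (intervalIntegral.continuous_primitive (μ := volume)
    (fun _ _ => hcont.intervalIntegrable _ _) a).continuousOn.congr fun x hx => ?_
  refine intervalIntegral.integral_congr fun u hu => ?_
  rw [uIcc_of_le hx] at hu
  simp only [max_eq_right hu.1]

theorem intervalIntegrable_of_continuousOn_Ici {E : Type*} [NormedAddCommGroup E]
    {f : ℝ → E} {c a b : ℝ} (hf : ContinuousOn f (Ici c)) (ha : c ≤ a) (hb : c ≤ b) :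
    IntervalIntegrable f volume a b :=
  (hf.mono fun _ hu => (le_min ha hb).trans hu.1).intervalIntegrable

theorem slowDecay_integral_div {g : ℝ → ℝ} (hg : ContinuousOn g (Ici 0))
    (hg0 : ∀ u, 0 ≤ u → 0 ≤ g u) (h : SlowDecay atTop log g) :
    SlowDecay atTop log fun x => (∫ u in (0 : ℝ)..x, g u) / x := by
  obtain ⟨b, hb, hle⟩ := h
  obtain ⟨x₀, hx₀⟩ := eventually_atTop.1 (hle.and (eventually_ge_atTop 1))
  have hx₀1 : 1 ≤ x₀ := (hx₀ x₀ le_rfl).2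
  have hexp : SlowDecay atTop log fun x => 1 / 2 * exp (-log x ^ b) :=
    SlowDecay.const_mul ⟨b, hb, .of_forall fun _ => le_rfl⟩ tendsto_log_atTop one_half_pos
  refine hexp.mono ?_
  filter_upwards [eventually_ge_atTop (2 * x₀)] with x hx
  have hx0 : 0 < x := by linarith
  have hmean : (x - x₀) * exp (-log x ^ b) ≤ ∫ u in x₀..x, g u := by
    rw [← smul_eq_mul, ← intervalIntegral.integral_const]
    refine intervalIntegral.integral_mono_on (by linarith) (by simp)
      (intervalIntegrable_of_continuousOn_Ici hg (by linarith) hx0.le) fun u hu => ?_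
    obtain ⟨hgu, hu1⟩ := hx₀ u hu.1
    refine le_trans ?_ hgu
    have hlog : log u ≤ log x := log_le_log (by linarith) hu.2
    have hlogu : 0 ≤ log u := log_nonneg hu1
    have hb0 : 0 ≤ b := hb.1.le
    gcongr
  have hsub : ∫ u in x₀..x, g u ≤ ∫ u in (0 : ℝ)..x, g u := by
    refine intervalIntegral.integral_mono_interval (by linarith) (by linarith) le_rfl ?_
      (intervalIntegrable_of_continuousOn_Ici hg le_rfl hx0.le)
    filter_upwards [ae_restrict_mem measurableSet_Ioc] with u hu using hg0 u hu.1.le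
  rw [le_div_iff₀ hx0]
  calc 1 / 2 * exp (-log x ^ b) * x = x / 2 * exp (-log x ^ b) := by ring
    _ ≤ (x - x₀) * exp (-log x ^ b) := by gcongr; linarith
    _ ≤ ∫ u in (0 : ℝ)..x, g u := hmean.trans hsub

end Primitive

theorem W_zero (w : ℝ → ℝ) : W w 0 = 0 := intervalIntegral.integral_same

namespace IsWeightFunction

variable {w : ℝ → ℝ} {a b x y : ℝ}

theorem continuousOn_one_div (hw : IsWeightFunction w) : ContinuousOn (fun u => 1 / w u) (Ici 0) :=
  continuousOn_const.div hw.continuousOn fun u hu => (hw.pos u hu).ne'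

theorem intervalIntegrable_one_div (hw : IsWeightFunction w) (ha : 0 ≤ a) (hb : 0 ≤ b) :
    IntervalIntegrable (fun u => 1 / w u) volume a b :=
  intervalIntegrable_of_continuousOn_Ici hw.continuousOn_one_div ha hb

theorem W_sub_W (hw : IsWeightFunction w) (ha : 0 ≤ a) (hb : 0 ≤ b) :
    W w b - W w a = ∫ u in a..b, 1 / w u :=
  intervalIntegral.integral_interval_sub_left
    (hw.intervalIntegrable_one_div le_rfl hb) (hw.intervalIntegrable_one_div le_rfl ha)

theorem sub_div_le_W_sub_W (hw : IsWeightFunction w) (ha : 0 ≤ a) (hab : a ≤ b) :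
    (b - a) / w b ≤ W w b - W w a := by
  have hb : 0 ≤ b := ha.trans hab
  rw [hw.W_sub_W ha hb, div_eq_mul_one_div, ← smul_eq_mul, ← intervalIntegral.integral_const]
  refine intervalIntegral.integral_mono_on hab (by simp) (hw.intervalIntegrable_one_div ha hb)
    fun u hu => ?_
  have hu0 : 0 ≤ u := ha.trans hu.1
  exact one_div_le_one_div_of_le (hw.pos u hu0) (hw.monotoneOn hu0 hb hu.2)

theorem W_sub_W_le_sub_div (hw : IsWeightFunction w) (ha : 0 ≤ a) (hab : a ≤ b) :
    W w b - W w a ≤ (b - a) / w a := by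
  have hb : 0 ≤ b := ha.trans hab
  rw [hw.W_sub_W ha hb, div_eq_mul_one_div, ← smul_eq_mul, ← intervalIntegral.integral_const]
  refine intervalIntegral.integral_mono_on hab (hw.intervalIntegrable_one_div ha hb) (by simp)
    fun u hu => ?_
  exact one_div_le_one_div_of_le (hw.pos a ha) (hw.monotoneOn ha (ha.trans hu.1) hu.1)

theorem div_le_W (hw : IsWeightFunction w) (hx : 0 ≤ x) : x / w x ≤ W w x := by
  simpa only [sub_zero, W_zero] using hw.sub_div_le_W_sub_W le_rfl hx

theorem W_le_div (hw : IsWeightFunction w) (hx : 0 ≤ x) : W w x ≤ x / w 0 := by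
  simpa only [sub_zero, W_zero] using hw.W_sub_W_le_sub_div le_rfl hx

theorem W_nonneg (hw : IsWeightFunction w) (hx : 0 ≤ x) : 0 ≤ W w x :=
  (div_nonneg hx (hw.pos x hx).le).trans (hw.div_le_W hx)

theorem strictMonoOn_W (hw : IsWeightFunction w) : StrictMonoOn (W w) (Ici 0) := by
  intro a ha b hb hab
  have hpos : 0 < (b - a) / w b := div_pos (sub_pos.2 hab) (hw.pos b hb)
  linarith [hw.sub_div_le_W_sub_W ha hab.le]

theorem continuousOn_W (hw : IsWeightFunction w) : ContinuousOn (W w) (Ici 0) :=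
  continuousOn_intervalIntegral_Ici hw.continuousOn_one_div

theorem bijOn_W (hw : IsWeightFunction w) (hW : Tendsto (W w) atTop atTop) :
    BijOn (W w) (Ici 0) (Ici 0) := by
  refine ⟨fun x hx => hw.W_nonneg hx, hw.strictMonoOn_W.injOn, fun y hy => ?_⟩
  obtain ⟨b, hyb, hb⟩ := ((hW.eventually_ge_atTop y).and (eventually_ge_atTop 0)).exists
  obtain ⟨x, hx, rfl⟩ := intermediate_value_Icc hb (hw.continuousOn_W.mono Icc_subset_Ici_self)
    ⟨(W_zero w).trans_le hy, hyb⟩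
  exact ⟨x, hx.1, rfl⟩

theorem bijOn_Winv (hw : IsWeightFunction w) (hW : Tendsto (W w) atTop atTop) :
    BijOn (Winv w) (Ici 0) (Ici 0) :=
  (hw.bijOn_W hW).symm (hw.bijOn_W hW).invOn_invFunOn.symm

theorem Winv_nonneg (hw : IsWeightFunction w) (hW : Tendsto (W w) atTop atTop) (hy : 0 ≤ y) :
    0 ≤ Winv w y :=
  (hw.bijOn_Winv hW).mapsTo hy

theorem W_Winv (hw : IsWeightFunction w) (hW : Tendsto (W w) atTop atTop) (hy : 0 ≤ y) :
    W w (Winv w y) = y :=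
  (hw.bijOn_W hW).invOn_invFunOn.2 hy

theorem monotoneOn_Winv (hw : IsWeightFunction w) (hW : Tendsto (W w) atTop atTop) :
    MonotoneOn (Winv w) (Ici 0) := by
  intro x hx y hy hxy
  rwa [← hw.strictMonoOn_W.le_iff_le (hw.Winv_nonneg hW hx) (hw.Winv_nonneg hW hy),
    hw.W_Winv hW hx, hw.W_Winv hW hy]

theorem continuousOn_Winv (hw : IsWeightFunction w) (hW : Tendsto (W w) atTop atTop) :
    ContinuousOn (Winv w) (Ici 0) := by
  have hbij := hw.bijOn_Winv hW
  have hmono : Monotone (hbij.mapsTo.restrict (Winv w) (Ici 0) (Ici 0)) := fun x y hxy =>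
    hw.monotoneOn_Winv hW x.2 y.2 hxy
  exact continuousOn_iff_continuous_domRestrict.2 (continuous_subtype_val.comp
    (hmono.continuous_of_surjective (hbij.mapsTo.restrict_surjective_iff.2 hbij.surjOn)))

theorem tendsto_atTop_of_tendsto_W (hw : IsWeightFunction w) {ι : Type*} {l : Filter ι} {p : ι → ℝ}
    (hp : ∀ᶠ i in l, 0 ≤ p i) (hWp : Tendsto (fun i => W w (p i)) l atTop) : Tendsto p l atTop := by
  refine tendsto_atTop.2 fun c => ?_
  filter_upwards [hp, hWp.eventually_gt_atTop (W w (max c 0))] with i hpi hi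
  exact (le_max_left c 0).trans
    ((hw.strictMonoOn_W.lt_iff_lt (le_max_right c 0) hpi).1 hi).le

theorem tendsto_Winv (hw : IsWeightFunction w) (hW : Tendsto (W w) atTop atTop) :
    Tendsto (Winv w) atTop atTop := by
  refine hw.tendsto_atTop_of_tendsto_W ((eventually_ge_atTop 0).mono fun y => hw.Winv_nonneg hW) ?_
  exact tendsto_id.congr' ((eventually_ge_atTop 0).mono fun y hy => (hw.W_Winv hW hy).symm)

theorem continuousOn_weight_comp_Winv (hw : IsWeightFunction w) (hW : Tendsto (W w) atTop atTop) :
    ContinuousOn (fun u => w (Winv w u)) (Ici 0) :=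
  hw.continuousOn.comp (hw.continuousOn_Winv hW) (hw.bijOn_Winv hW).mapsTo

end IsWeightFunction

/-! ### Uniformly sublinear weights -/

namespace UniformlySublinear

variable {w : ℝ → ℝ}

theorem exists_rpow_mul_log_div_le (hs : UniformlySublinear w) (hw : IsWeightFunction w) {δ : ℝ}
    (hδ : 0 < δ) : ∃ x₀ > 1, ∀ x ≥ x₀, ∀ y ≥ x,
      log y ^ (-δ) * log (y / x) ≤ log (y / w y) - log (x / w x) := by
  obtain ⟨x₀, hx₀⟩ := eventually_atTop.1 (hs δ hδ)
  refine ⟨max x₀ 2, lt_max_of_lt_right one_lt_two, fun x hx y hxy => ?_⟩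
  have hx0 : 0 < x := two_pos.trans_le ((le_max_right _ _).trans hx)
  have hy0 : 0 < y := hx0.trans_le hxy
  have hwx := hw.pos x hx0.le
  have hwy := hw.pos y hy0.le
  have hslope := hx₀ x ((le_max_left _ _).trans hx) y hxy
  have hlog : log (y / w y) - log (x / w x) = log (y / x) - log (w y / w x) := by
    rw [log_div hy0.ne' hwy.ne', log_div hx0.ne' hwx.ne', log_div hy0.ne' hx0.ne',
      log_div hwy.ne' hwx.ne']
    ring
  linarith

theorem exists_monotoneOn_div (hs : UniformlySublinear w) (hw : IsWeightFunction w) :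
    ∃ x₀ > 1, MonotoneOn (fun x => x / w x) (Ici x₀) := by
  obtain ⟨x₀, hx₀, hslope⟩ := hs.exists_rpow_mul_log_div_le hw one_pos
  refine ⟨x₀, hx₀, fun x hx y _ hxy => ?_⟩
  have hx1 : 1 < x := hx₀.trans_le hx
  have hy1 : 1 < y := hx1.trans_le hxy
  have hnonneg : 0 ≤ log y ^ (-1 : ℝ) * log (y / x) :=
    mul_nonneg (rpow_nonneg (log_nonneg hy1.le) _)
      (log_nonneg ((one_le_div (by linarith)).2 hxy))
  rw [← log_le_log_iff (div_pos (by linarith) (hw.pos x (by linarith)))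
    (div_pos (by linarith) (hw.pos y (by linarith)))]
  linarith [hslope x hx y hxy]

theorem eventually_exp_rpow_le_div (hs : UniformlySublinear w) (hw : IsWeightFunction w) {c : ℝ}
    (hc : c < 1) : ∀ᶠ x in atTop, exp (log x ^ c) ≤ x / w x := by
  obtain ⟨e, hce, he⟩ := exists_between (max_lt hc one_pos)
  obtain ⟨hce, he0⟩ := max_lt_iff.1 hce
  obtain ⟨x₀, hx₀, hslope⟩ := hs.exists_rpow_mul_log_div_le hw (sub_pos.2 he)
  have hdom : Tendsto (fun t : ℝ => t ^ e - 1 * t ^ c) atTop atTop :=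
    tendsto_rpow_sub_const_mul_rpow_atTop he0 hce 1
  filter_upwards [eventually_ge_atTop x₀, tendsto_log_atTop.eventually_ge_atTop 1,
    tendsto_log_atTop.eventually (hdom.eventually_ge_atTop (log x₀ - log (x₀ / w x₀)))]
    with x hx hlogx hd
  have hsplit : log x ^ (-(1 - e)) * log x = log x ^ e := by
    rw [← rpow_add_one (by linarith)]
    ring_nf
  have hle1 : log x ^ (-(1 - e)) ≤ 1 := rpow_le_one_of_one_le_of_nonpos hlogx (by linarith)
  have hloss : log x ^ (-(1 - e)) * log x₀ ≤ log x₀ := mul_le_of_le_one_left (log_pos hx₀).le hle1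
  have hgrow := hslope x₀ le_rfl x hx
  rw [log_div (by linarith) (by linarith), mul_sub, hsplit] at hgrow
  rw [← le_log_iff_exp_le (div_pos (by linarith) (hw.pos x (by linarith)))]
  linarith

theorem tendsto_div (hs : UniformlySublinear w) (hw : IsWeightFunction w) :
    Tendsto (fun x => x / w x) atTop atTop := by
  refine tendsto_atTop_mono' _ (hs.eventually_exp_rpow_le_div hw one_half_lt_one) ?_
  exact tendsto_exp_atTop.comp ((tendsto_rpow_atTop one_half_pos).comp tendsto_log_atTop)

theorem tendsto_W (hs : UniformlySublinear w) (hw : IsWeightFunction w) :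
    Tendsto (W w) atTop atTop :=
  tendsto_atTop_mono' _ ((eventually_ge_atTop 0).mono fun _ hx => hw.div_le_W hx)
    (hs.tendsto_div hw)

theorem eventually_W_le (hs : UniformlySublinear w) (hw : IsWeightFunction w) :
    ∀ᶠ x in atTop, W w x ≤ x / w x * log x ^ 2 := by
  obtain ⟨x₀, hx₀, hmono⟩ := hs.exists_monotoneOn_div hw
  have hx₀0 : 0 < x₀ := by linarith
  filter_upwards [eventually_ge_atTop x₀, tendsto_log_atTop.eventually_ge_atTop 2,
    (hs.tendsto_div hw).eventually_ge_atTop (W w x₀)] with x hx hlogx hWx₀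
  have hx0 : 0 < x := hx₀0.trans_le hx
  have hL : 0 ≤ x / w x := div_nonneg hx0.le (hw.pos x hx0.le).le
  have hint : ∫ u in x₀..x, 1 / w u ≤ ∫ u in x₀..x, x / w x * (1 / u) := by
    refine intervalIntegral.integral_mono_on hx (hw.intervalIntegrable_one_div hx₀0.le hx0.le)
      ((intervalIntegral.intervalIntegrable_one_div (fun u hu => ?_) continuousOn_id).const_mul _)
      fun u hu => ?_
    · rw [uIcc_of_le hx] at hu
      exact (hx₀0.trans_le hu.1).ne'
    · have hu0 : 0 < u := hx₀0.trans_le hu.1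
      calc 1 / w u = u / w u * (1 / u) := by field_simp
        _ ≤ x / w x * (1 / u) :=
          mul_le_mul_of_nonneg_right (hmono hu.1 hx hu.2) (one_div_nonneg.2 hu0.le)
  rw [← hw.W_sub_W hx₀0.le hx0.le, intervalIntegral.integral_const_mul,
    integral_one_div_of_pos hx₀0 hx0, log_div hx0.ne' hx₀0.ne'] at hint
  calc W w x ≤ x / w x + x / w x * log x := by nlinarith [log_pos hx₀]
    _ = x / w x * (1 + log x) := by ring
    _ ≤ x / w x * log x ^ 2 := by gcongr; nlinarith

theorem tendsto_atTop_of_slowDecay_W (hs : UniformlySublinear w) (hw : IsWeightFunction w)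
    {ι : Type*} {l : Filter ι} {m p : ι → ℝ} (hm : Tendsto m l atTop) (hp : ∀ᶠ i in l, 0 ≤ p i)
    (h : SlowDecay l (fun i => log (m i)) fun i => W w (p i) / (m i / w (m i))) :
    Tendsto p l atTop := by
  refine hw.tendsto_atTop_of_tendsto_W hp ((h.tendsto_mul_atTop (tendsto_log_atTop.comp hm)
    fun c hc => hm.eventually (hs.eventually_exp_rpow_le_div hw hc)).congr' ?_)
  filter_upwards [hm.eventually_gt_atTop 0] with i hi
  exact mul_div_cancel₀ _ (div_pos hi (hw.pos _ hi.le)).ne'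

/- Where `p < m`, the slope bound makes `log m - log p` at most `(log m) ^ δ` times
`log (m / w m) - log (p / w p)`, while `W p` exceeds `p / w p` by at most a factor `(log p) ^ 2`. -/
theorem slowDecay_div (hs : UniformlySublinear w) (hw : IsWeightFunction w)
    {ι : Type*} {l : Filter ι} {m p : ι → ℝ} (hm : Tendsto m l atTop) (hp : ∀ᶠ i in l, 0 ≤ p i)
    (h : SlowDecay l (fun i => log (m i)) fun i => W w (p i) / (m i / w (m i))) :
    SlowDecay l (fun i => log (m i)) fun i => p i / m i := by
  have hp_top := hs.tendsto_atTop_of_slowDecay_W hw hm hp h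
  have hlogm := tendsto_log_atTop.comp hm
  obtain ⟨a, ⟨ha0, ha1⟩, hle⟩ := h
  obtain ⟨b, hab, hb1⟩ := exists_between ha1
  obtain ⟨d, had, hdb⟩ := exists_between hab
  obtain ⟨x₀, hx₀, hslope⟩ := hs.exists_rpow_mul_log_div_le hw (sub_pos.2 had)
  refine ⟨b, ⟨ha0.trans hab, hb1⟩, ?_⟩
  filter_upwards [hle, hp_top.eventually (hs.eventually_W_le hw), hp_top.eventually_ge_atTop x₀,
    hm.eventually_gt_atTop 1, hlogm.eventually (eventually_const_mul_log_le_rpow ha0 2),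
    hlogm.eventually (eventually_const_mul_rpow_le_rpow hdb 2)] with i hWi hWp hpx₀ hm1 h2log h2pow
  have hp1 : 1 < p i := hx₀.trans_le hpx₀
  have hp0 : 0 < p i := by linarith
  have hm0 : 0 < m i := by linarith
  have ht0 : 0 < log (m i) := log_pos hm1
  rw [← le_log_iff_exp_le (div_pos hp0 hm0), log_div hp0.ne' hm0.ne']
  rcases le_total (m i) (p i) with hmp | hpm
  · linarith [log_le_log hm0 hmp, rpow_nonneg ht0.le b]
  have hLm : 0 < m i / w (m i) := div_pos hm0 (hw.pos _ hm0.le)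
  have hLp : 0 < p i / w (p i) := div_pos hp0 (hw.pos _ hp0.le)
  have hlogW : log (m i / w (m i)) - log (m i) ^ a ≤ log (p i / w (p i)) + 2 * log (log (m i)) := by
    have hexp : exp (-log (m i) ^ a) * (m i / w (m i)) ≤ p i / w (p i) * log (p i) ^ 2 :=
      ((le_div_iff₀ hLm).1 hWi).trans hWp
    have hlog := log_le_log (mul_pos (exp_pos _) hLm) hexp
    rw [log_mul (exp_pos _).ne' hLm.ne', log_exp,
      log_mul hLp.ne' (pow_pos (log_pos hp1) 2).ne', log_pow] at hlog
    have hloglog := log_le_log (log_pos hp1) (log_le_log hp0 hpm)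
    push_cast at hlog
    linarith
  have hgap : log (m i) ^ (-(d - a)) * (log (m i) - log (p i)) ≤ 2 * log (m i) ^ a := by
    have hgrow := hslope (p i) hpx₀ (m i) hpm
    rw [log_div hm0.ne' hp0.ne'] at hgrow
    simp only [Function.comp_apply] at h2log
    linarith
  rw [rpow_neg ht0.le, inv_mul_le_iff₀ (rpow_pos_of_pos ht0 _), mul_left_comm, ← rpow_add ht0,
    sub_add_cancel] at hgap
  simp only [Function.comp_apply] at h2pow
  linarith

theorem slowDecay_weight_div (hs : UniformlySublinear w) (hw : IsWeightFunction w)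
    {ι : Type*} {l : Filter ι} {m p : ι → ℝ} (hm : Tendsto m l atTop)
    (h : SlowDecay l (fun i => log (m i)) fun i => p i / m i) :
    SlowDecay l (fun i => log (m i)) fun i => w (p i) / w (m i) := by
  have hlogm := tendsto_log_atTop.comp hm
  have hp : Tendsto p l atTop := by
    refine (h.tendsto_mul_atTop hlogm fun c hc =>
      hm.eventually (eventually_exp_log_rpow_le hc)).congr' ?_
    filter_upwards [hm.eventually_gt_atTop 0] with i hi using mul_div_cancel₀ _ hi.ne'
  obtain ⟨x₀, hx₀, hmono⟩ := hs.exists_monotoneOn_div hw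
  refine (h.min_one hlogm).mono ?_
  filter_upwards [hp.eventually_ge_atTop x₀, hm.eventually_ge_atTop x₀] with i hpi hmi
  have hp0 : 0 < p i := by linarith
  have hm0 : 0 < m i := by linarith
  have hwp := hw.pos _ hp0.le
  have hwm := hw.pos _ hm0.le
  rcases le_total (m i) (p i) with hmp | hpm
  · exact (min_le_left _ _).trans ((one_le_div hwm).2 (hw.monotoneOn hm0.le hp0.le hmp))
  · refine (min_le_right _ _).trans ?_
    have hL : p i / w (p i) ≤ m i / w (m i) := hmono hpi hmi hpm
    rw [div_le_div_iff₀ hwp hwm] at hL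
    rwa [div_le_div_iff₀ hm0 hwm, mul_comm (w (p i))]

theorem eventually_log_W_le (hs : UniformlySublinear w) (hw : IsWeightFunction w) {κ : ℝ}
    (hκ : 1 < κ) : ∀ᶠ x in atTop, log (W w x) ≤ log x ^ κ := by
  have hdom : Tendsto (fun t : ℝ => t ^ κ - 1 * t ^ (1 : ℝ)) atTop atTop :=
    tendsto_rpow_sub_const_mul_rpow_atTop (one_pos.trans hκ) hκ 1
  filter_upwards [tendsto_log_atTop.eventually (hdom.eventually_ge_atTop (-log (w 0))),
    eventually_gt_atTop 0, (hs.tendsto_W hw).eventually_gt_atTop 0] with x hd hx hWx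
  rw [one_mul, rpow_one] at hd
  have hlog := log_le_log hWx (hw.W_le_div hx.le)
  rw [log_div hx.ne' (hw.pos 0 le_rfl).ne'] at hlog
  linarith

theorem eventually_log_le_log_W_rpow (hs : UniformlySublinear w) (hw : IsWeightFunction w) {κ : ℝ}
    (hκ : 1 < κ) : ∀ᶠ x in atTop, log x ≤ log (W w x) ^ κ := by
  have hκ0 : 0 < κ := one_pos.trans hκ
  filter_upwards [hs.eventually_exp_rpow_le_div hw (inv_lt_one_of_one_lt₀ hκ),
    eventually_ge_atTop 1] with x hexp hx
  have hlogx : 0 ≤ log x := log_nonneg hx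
  have hW : exp (log x ^ κ⁻¹) ≤ W w x := hexp.trans (hw.div_le_W (by linarith))
  calc log x = (log x ^ κ⁻¹) ^ κ := (rpow_inv_rpow hlogx hκ0.ne').symm
    _ ≤ log (W w x) ^ κ := by
      have hlogW := (le_log_iff_exp_le ((exp_pos _).trans_le hW)).2 hW
      gcongr

end UniformlySublinear

/-! ### Iterates of `G` -/

/-- Continuous functions `[0,∞) → [0,∞)` that stay above `x exp (-(log x) ^ b)` at infinity, for
some `b < 1`. For uniformly sublinear `w` this class is invariant under `G`. -/
structure AlmostLinear (f : ℝ → ℝ) : Prop where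
  continuousOn : ContinuousOn f (Ici 0)
  nonneg : ∀ x, 0 ≤ x → 0 ≤ f x
  slowDecay : SlowDecay atTop log fun x => f x / x

namespace AlmostLinear

variable {w f : ℝ → ℝ}

theorem const_mul_id {η : ℝ} (hη : 0 < η) : AlmostLinear fun x => η * x where
  continuousOn := by fun_prop
  nonneg x hx := mul_nonneg hη.le hx
  slowDecay := by
    refine (SlowDecay.const tendsto_log_atTop hη).mono ?_
    filter_upwards [eventually_ne_atTop 0] with x hx using (mul_div_cancel_right₀ η hx).ge

theorem tendsto_atTop (hf : AlmostLinear f) : Tendsto f atTop atTop := by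
  refine (hf.slowDecay.tendsto_mul_atTop tendsto_log_atTop
    fun c hc => eventually_exp_log_rpow_le hc).congr' ?_
  filter_upwards [eventually_ne_atTop 0] with x hx using mul_div_cancel₀ _ hx

theorem slowDecay_weight_div (hf : AlmostLinear f) (hs : UniformlySublinear w)
    (hw : IsWeightFunction w) :
    SlowDecay atTop log fun x => w (Winv w (f x)) / w (Winv w x) := by
  have hW := hs.tendsto_W hw
  have hm := hw.tendsto_Winv hW
  have hx : ∀ᶠ x in atTop, W w (Winv w x) = x :=
    (eventually_ge_atTop 0).mono fun x hx => hw.W_Winv hW hx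
  have hlogm : ∀ᶠ x in atTop, 0 ≤ log (Winv w x) :=
    (tendsto_log_atTop.comp hm).eventually_ge_atTop 0
  have hlogx : ∀ᶠ x : ℝ in atTop, 0 ≤ log x := tendsto_log_atTop.eventually_ge_atTop 0
  have hf' : SlowDecay atTop (fun x => log (Winv w x)) fun x => f x / x := by
    refine hf.slowDecay.of_le_rpow hlogx hlogm fun κ hκ => ?_
    filter_upwards [hx, hm.eventually (hs.eventually_log_W_le hw hκ)] with x hx hκx
    rwa [hx] at hκx
  have hWp : SlowDecay atTop (fun x => log (Winv w x)) fun x =>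
      W w (Winv w (f x)) / (Winv w x / w (Winv w x)) := by
    refine hf'.mono ?_
    filter_upwards [hx, eventually_ge_atTop 0, hm.eventually_gt_atTop 0] with x hx hx0 hmx
    have hfx := hf.nonneg x hx0
    have hLx : 0 < Winv w x / w (Winv w x) := div_pos hmx (hw.pos _ hmx.le)
    rw [hw.W_Winv hW hfx]
    exact div_le_div_of_nonneg_left hfx hLx ((hw.div_le_W hmx.le).trans_eq hx)
  have hp : ∀ᶠ x in atTop, 0 ≤ Winv w (f x) :=
    (eventually_ge_atTop 0).mono fun x hx0 => hw.Winv_nonneg hW (hf.nonneg x hx0)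
  refine (hs.slowDecay_weight_div hw hm (hs.slowDecay_div hw hm hp hWp)).of_le_rpow hlogm hlogx
    fun κ hκ => ?_
  filter_upwards [hx, hm.eventually (hs.eventually_log_le_log_W_rpow hw hκ)] with x hx hκx
  rwa [hx] at hκx

theorem map_G (hf : AlmostLinear f) (hs : UniformlySublinear w) (hw : IsWeightFunction w) :
    AlmostLinear (G w f) := by
  have hW := hs.tendsto_W hw
  have hw_inv : ∀ y, 0 ≤ y → 0 < w (Winv w y) := fun y hy => hw.pos _ (hw.Winv_nonneg hW hy)
  have hcont : ContinuousOn (fun u => w (Winv w (f u)) / w (Winv w u)) (Ici 0) :=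
    ((hw.continuousOn_weight_comp_Winv hW).comp hf.continuousOn hf.nonneg).div
      (hw.continuousOn_weight_comp_Winv hW) fun u hu => (hw_inv u hu).ne'
  have hnonneg : ∀ u, 0 ≤ u → 0 ≤ w (Winv w (f u)) / w (Winv w u) := fun u hu =>
    div_nonneg (hw_inv _ (hf.nonneg u hu)).le (hw_inv u hu).le
  exact ⟨continuousOn_intervalIntegral_Ici hcont,
    fun x hx => intervalIntegral.integral_nonneg hx fun u hu => hnonneg u hu.1,
    slowDecay_integral_div hcont hnonneg (hf.slowDecay_weight_div hs hw)⟩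

theorem iterate_G (hf : AlmostLinear f) (hs : UniformlySublinear w) (hw : IsWeightFunction w)
    (n : ℕ) : AlmostLinear ((G w)^[n] f) :=
  Function.Iterate.rec AlmostLinear hf (fun _ hg => hg.map_G hs hw) n

end AlmostLinear

theorem UniformlySublinear.index_eq_top {w : ℝ → ℝ} (hs : UniformlySublinear w)
    (hw : IsWeightFunction w) {η : ℝ} (hη : 0 < η) : index w η = ⊤ := by
  refine sInf_eq_top.2 ?_
  rintro _ ⟨n, ⟨-, C, hC⟩, rfl⟩
  have htop := ((AlmostLinear.const_mul_id hη).iterate_G hs hw (n - 1)).tendsto_atTop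
  obtain ⟨x, hCx, hx⟩ := ((htop.eventually_gt_atTop C).and (eventually_ge_atTop 0)).exists
  exact absurd ((le_abs_self _).trans (hC x hx)) hCx.not_ge

theorem UniformlySublinear.isLittleO_div_exp {w : ℝ → ℝ} (hs : UniformlySublinear w)
    (hw : IsWeightFunction w) {α : ℝ} (hα : α < 1) :
    w =o[atTop] fun x => x / exp (log x ^ α) := by
  obtain ⟨β, hαβ, hβ1⟩ := exists_between (max_lt hα one_pos)
  obtain ⟨hαβ, hβ0⟩ := max_lt_iff.1 hαβ
  have hdecay : SlowDecay atTop log fun x => exp (-log x ^ α) := by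
    refine ⟨β, ⟨hβ0, hβ1⟩, ?_⟩
    filter_upwards [tendsto_log_atTop.eventually_ge_atTop 1] with x hx
    gcongr
  have htop := hdecay.tendsto_mul_atTop tendsto_log_atTop
    fun c hc => hs.eventually_exp_rpow_le_div hw hc
  rw [isLittleO_iff_tendsto']
  · refine (tendsto_inv_atTop_zero.comp htop).congr' ?_
    filter_upwards with x
    rw [Function.comp_apply, exp_neg, mul_inv, inv_inv, inv_div, div_div_eq_mul_div,
      div_mul_eq_mul_div]
  · filter_upwards [eventually_gt_atTop 0] with x hx hzero
    exact absurd hzero (div_pos hx (exp_pos _)).ne'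

/-! ### The exponential supermartingale -/

section Energy

theorem visits_congr {x x' : ℕ → ℤ} {n : ℕ} (h : ∀ i ≤ n, x i = x' i) (y : ℤ) :
    visits x n y = visits x' n y := by
  refine congrArg Finset.card (Finset.filter_congr fun i hi => ?_)
  rw [h i (Finset.mem_range_succ_iff.1 hi)]

theorem visits_succ (x : ℕ → ℤ) (n : ℕ) (y : ℤ) :
    visits x (n + 1) y = visits x n y + if x (n + 1) = y then 1 else 0 := by
  simp only [visits, Finset.card_filter]
  exact Finset.sum_range_succ _ _

theorem visits_le (x : ℕ → ℤ) (n : ℕ) (y : ℤ) : visits x n y ≤ n + 1 :=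
  (Finset.card_filter_le _ _).trans_eq (Finset.card_range _)

/-- The probability that the reinforced walk, having followed the path `x` up to time `n` and
sitting at `y`, jumps to `y + 1`. -/
noncomputable def rightProb (w : ℕ → ℝ) (x : ℕ → ℤ) (n : ℕ) (y : ℤ) : ℝ :=
  w (visits x n (y + 1)) / (w (visits x n (y - 1)) + w (visits x n (y + 1)))

/-- The compensator, up to time `n`, of the sum of `1 / w (visits x k (y + 1))` over the jumps
`k → k + 1` from `y` to `y + 1`. -/
noncomputable def drift (w : ℕ → ℝ) (x : ℕ → ℤ) (y : ℤ) (n : ℕ) : ℝ :=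
  ∑ k ∈ Finset.range n,
    if x k = y then 1 / (w (visits x k (y - 1)) + w (visits x k (y + 1))) else 0

/-- The sum of the first `z` inverse weights, a discrete version of `W`. -/
noncomputable def invSum (w : ℕ → ℝ) (z : ℕ) : ℝ := ∑ j ∈ Finset.range z, 1 / w j

/-- An exponential functional comparing the time spent at `y` with the number of visits to `y + 1`.
When `c` is a lower bound for the weights it is a supermartingale along the reinforced walk: the
drift is counted only half, which leaves room for the second order term of the exponential. -/
noncomputable def energy (c : ℝ) (w : ℕ → ℝ) (x : ℕ → ℤ) (y : ℤ) (n : ℕ) : ℝ :=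
  exp (c * (drift w x y n / 2 - invSum w (visits x n (y + 1))))

variable {c : ℝ} {w : ℕ → ℝ} {x x' : ℕ → ℤ} {y : ℤ} {n : ℕ}

theorem rightProb_nonneg (hw : ∀ n, 0 < w n) : 0 ≤ rightProb w x n y :=
  div_nonneg (hw _).le (add_pos (hw _) (hw _)).le

theorem rightProb_le_one (hw : ∀ n, 0 < w n) : rightProb w x n y ≤ 1 :=
  (div_le_one (add_pos (hw _) (hw _))).2 (le_add_of_nonneg_left (hw _).le)

theorem rightProb_congr (h : ∀ i ≤ n, x i = x' i) : rightProb w x n y = rightProb w x' n y := by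
  simp only [rightProb, visits_congr h]

theorem energy_congr (h : ∀ i ≤ n, x i = x' i) : energy c w x y n = energy c w x' y n := by
  have hd : drift w x y n = drift w x' y n := by
    refine Finset.sum_congr rfl fun k hk => ?_
    have hkn : k ≤ n := (Finset.mem_range.1 hk).le
    simp only [h k hkn, visits_congr fun i hi => h i (le_trans hi hkn)]
  rw [energy, energy, hd, visits_congr h]

theorem energy_zero_le_one (hc : 0 ≤ c) (hw : ∀ n, 0 ≤ w n) : energy c w x y 0 ≤ 1 := by
  have hinv : 0 ≤ invSum w (visits x 0 (y + 1)) :=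
    Finset.sum_nonneg fun j _ => one_div_nonneg.2 (hw j)
  rw [energy, exp_le_one_iff, drift, Finset.sum_range_zero, zero_div, zero_sub]
  exact mul_nonpos_of_nonneg_of_nonpos hc (neg_nonpos.2 hinv)

theorem energy_succ : energy c w x y (n + 1) = energy c w x y n *
    exp (c * ((if x n = y then 1 / (w (visits x n (y - 1)) + w (visits x n (y + 1))) else 0) / 2 -
      if x (n + 1) = y + 1 then 1 / w (visits x n (y + 1)) else 0)) := by
  have hinv : invSum w (visits x (n + 1) (y + 1)) = invSum w (visits x n (y + 1)) +
      if x (n + 1) = y + 1 then 1 / w (visits x n (y + 1)) else 0 := by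
    rw [visits_succ]
    split_ifs
    · exact Finset.sum_range_succ _ _
    · exact (add_zero _).symm
  rw [energy, energy, ← exp_add, hinv, drift, Finset.sum_range_succ, ← drift]
  ring_nf

theorem energy_succ_le_of_ne (hc : 0 ≤ c) (hw : ∀ n, 0 ≤ w n) (hxy : x n ≠ y) :
    energy c w x y (n + 1) ≤ energy c w x y n := by
  rw [energy_succ, if_neg hxy, zero_div, zero_sub]
  refine mul_le_of_le_one_right (exp_pos _).le (exp_le_one_iff.2 ?_)
  refine mul_nonpos_of_nonneg_of_nonpos hc (neg_nonpos.2 ?_)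
  split_ifs
  · exact one_div_nonneg.2 (hw _)
  · rfl

theorem energy_succ_of_ne_add_one (hw : ∀ n, 0 < w n) (hxy : x n = y) (hx : x (n + 1) ≠ y + 1) :
    energy c w x y (n + 1) =
      energy c w x y n * exp (rightProb w x n y * (c / (2 * w (visits x n (y + 1))))) := by
  have hr := hw (visits x n (y + 1))
  rw [energy_succ, if_pos hxy, if_neg hx, rightProb]
  congr 2
  field_simp
  ring

theorem energy_succ_of_eq_add_one (hw : ∀ n, 0 < w n) (hxy : x n = y) (hx : x (n + 1) = y + 1) :
    energy c w x y (n + 1) =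
      energy c w x y n * (exp (rightProb w x n y * (c / (2 * w (visits x n (y + 1))))) *
        exp (-(2 * (c / (2 * w (visits x n (y + 1))))))) := by
  have hr := hw (visits x n (y + 1))
  rw [energy_succ, if_pos hxy, if_pos hx, rightProb, ← exp_add]
  congr 2
  field_simp
  ring

theorem exp_mul_average_le_one {p t : ℝ} (hp : 0 ≤ p) (ht : 0 ≤ t) (ht' : t ≤ 1 / 2) :
    exp (p * t) * (p * exp (-(2 * t)) + (1 - p)) ≤ 1 := by
  have hexp : exp (-(2 * t)) ≤ 1 - t := by
    rw [exp_neg, inv_le_comm₀ (exp_pos _) (by linarith)]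
    refine le_trans ?_ (add_one_le_exp (2 * t))
    rw [inv_le_iff_one_le_mul₀ (by linarith)]
    nlinarith
  calc exp (p * t) * (p * exp (-(2 * t)) + (1 - p))
      ≤ exp (p * t) * (p * (1 - t) + (1 - p)) := by gcongr
    _ = exp (p * t) * (-(p * t) + 1) := by ring
    _ ≤ exp (p * t) * exp (-(p * t)) := by gcongr; exact add_one_le_exp _
    _ = 1 := by rw [← exp_add, add_neg_cancel, exp_zero]

end Energy

section Walk

variable {Ω : Type*} [MeasurableSpace Ω] {X : ℕ → Ω → ℤ} {μ : Measure Ω} {c : ℝ} {w : ℕ → ℝ}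

theorem measurable_visits (hX : ∀ n, Measurable (X n)) (n : ℕ) (y : ℤ) :
    Measurable fun ω => visits (fun k => X k ω) n y := by
  simp only [visits, Finset.card_filter]
  exact Finset.measurable_sum _ fun i _ =>
    Measurable.ite (hX i (measurableSet_singleton y)) measurable_const measurable_const

theorem measurable_energy (hX : ∀ n, Measurable (X n)) (y : ℤ) (n : ℕ) :
    Measurable fun ω => energy c w (fun k => X k ω) y n := by
  have hw : ∀ k z, Measurable fun ω => w (visits (fun k => X k ω) k z) := fun k z =>
    measurable_from_top.comp (measurable_visits hX k z)
  have hinv : Measurable fun ω => invSum w (visits (fun k => X k ω) n (y + 1)) :=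
    (measurable_from_top (f := invSum w)).comp (measurable_visits hX n (y + 1))
  have hdrift : Measurable fun ω => drift w (fun k => X k ω) y n :=
    Finset.measurable_sum _ fun k _ => Measurable.ite (hX k (measurableSet_singleton y))
      (measurable_const.div ((hw k (y - 1)).add (hw k (y + 1)))) measurable_const
  exact (((hdrift.div_const 2).sub hinv).const_mul c).exp

theorem measurableSet_history (hX : ∀ n, Measurable (X n)) (x : ℕ → ℤ) (n : ℕ) :
    MeasurableSet (history X x n) := by
  simp only [history, ofPred_forall]
  exact MeasurableSet.iInter fun i => MeasurableSet.iInter fun _ =>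
    hX i (measurableSet_singleton _)

theorem lintegral_le_of_setLIntegral_history_le (hX : ∀ n, Measurable (X n)) (n : ℕ)
    {f g : Ω → ENNReal}
    (h : ∀ x, ∫⁻ ω in history X x n, f ω ∂μ ≤ ∫⁻ ω in history X x n, g ω ∂μ) :
    ∫⁻ ω, f ω ∂μ ≤ ∫⁻ ω, g ω ∂μ := by
  let path : (Fin (n + 1) → ℤ) → ℕ → ℤ := fun s i => s ⟨min i n, by omega⟩
  have hpath : ∀ s (i : Fin (n + 1)), path s i = s i := fun s i =>
    congrArg s (Fin.ext (min_eq_left (Nat.le_of_lt_succ i.2)))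
  have hcover : ⋃ s, history X (path s) n = univ :=
    eq_univ_of_forall fun ω => mem_iUnion.2
      ⟨fun i => X i ω, fun i hi => (hpath (fun i => X i ω) ⟨i, Nat.lt_succ_of_le hi⟩).symm⟩
  have hdisj : Pairwise (Function.onFun Disjoint fun s => history X (path s) n) := by
    refine fun s s' hne => Set.disjoint_left.2 fun ω hs hs' => hne (funext fun i => ?_)
    have hi : (i : ℕ) ≤ n := Nat.le_of_lt_succ i.2
    rw [← hpath s i, ← hpath s' i, ← hs i hi, ← hs' i hi]
  have hsum : ∀ f : Ω → ENNReal,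
      ∫⁻ ω, f ω ∂μ = ∑' s, ∫⁻ ω in history X (path s) n, f ω ∂μ := fun f => by
    rw [← lintegral_iUnion (fun s => measurableSet_history hX _ n) hdisj, hcover,
      setLIntegral_univ]
  rw [hsum f, hsum g]
  exact ENNReal.tsum_le_tsum fun s => h (path s)

theorem setLIntegral_eq_of_eq_inter_of_eq_sdiff {S R : Set Ω} (hS : MeasurableSet S)
    (hR : MeasurableSet R) {f : Ω → ENNReal} {a b : ENNReal} (ha : ∀ ω ∈ S ∩ R, f ω = a)
    (hb : ∀ ω ∈ S \ R, f ω = b) :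
    ∫⁻ ω in S, f ω ∂μ = a * μ (S ∩ R) + b * μ (S \ R) := by
  rw [← lintegral_inter_add_sdiff _ S hR, setLIntegral_congr_fun (hS.inter hR) ha,
    setLIntegral_congr_fun (hS.diff hR) hb, setLIntegral_const, setLIntegral_const]

theorem ae_exists_frequently_le_of_lintegral_le {F : ℕ → Ω → ENNReal}
    (hF : ∀ n, Measurable (F n)) {C : ENNReal} (hC : C ≠ ⊤) (hle : ∀ n, ∫⁻ ω, F n ω ∂μ ≤ C) :
    ∀ᵐ ω ∂μ, ∃ K : ENNReal, K ≠ ⊤ ∧ ∃ᶠ n in atTop, F n ω ≤ K := by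
  have hlim : ∫⁻ ω, liminf (fun n => F n ω) atTop ∂μ ≠ ⊤ :=
    ne_top_of_le_ne_top hC ((lintegral_liminf_le hF).trans
      ((liminf_le_liminf (.of_forall hle)).trans_eq (liminf_const _)))
  filter_upwards [ae_lt_top (Measurable.liminf hF) hlim] with ω hω
  obtain ⟨K, hlimK, hK⟩ := exists_between hω
  exact ⟨K, hK.ne, (frequently_lt_of_liminf_lt (by isBoundedDefault) hlimK).mono fun n hn => hn.le⟩

namespace IsVRRW

theorem measure_history_inter_right [IsFiniteMeasure μ] (hX : IsVRRW w X μ) (x : ℕ → ℤ) (n : ℕ) :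
    μ (history X x n ∩ {ω | X (n + 1) ω = x n + 1}) =
      ENNReal.ofReal (rightProb w x n (x n)) * μ (history X x n) := by
  rcases eq_or_ne (μ (history X x n)) 0 with hzero | hne
  · rw [hzero, mul_zero, measure_mono_null inter_subset_left hzero]
  · rw [← cond_mul_eq_inter (measurableSet_history hX.measurable x n), hX.right n x hne, rightProb]

theorem measure_history_sdiff_right [IsFiniteMeasure μ] (hX : IsVRRW w X μ) (hw : ∀ n, 0 < w n)
    (x : ℕ → ℤ) (n : ℕ) : μ (history X x n \ {ω | X (n + 1) ω = x n + 1}) =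
      ENNReal.ofReal (1 - rightProb w x n (x n)) * μ (history X x n) := by
  have hR : MeasurableSet {ω | X (n + 1) ω = x n + 1} :=
    hX.measurable (n + 1) (measurableSet_singleton _)
  rw [← ENNReal.add_right_inj (measure_ne_top μ (history X x n ∩ {ω | X (n + 1) ω = x n + 1})),
    measure_inter_add_sdiff _ hR, hX.measure_history_inter_right, ← add_mul,
    ← ENNReal.ofReal_add (rightProb_nonneg hw) (sub_nonneg.2 (rightProb_le_one hw)),
    add_sub_cancel, ENNReal.ofReal_one, one_mul]

theorem setLIntegral_energy_apply_succ_le [IsFiniteMeasure μ] (hX : IsVRRW w X μ) (hc : 0 < c)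
    (hcw : ∀ n, c ≤ w n) (x : ℕ → ℤ) (n : ℕ) :
    ∫⁻ ω in history X x n, ENNReal.ofReal (energy c w (fun k => X k ω) (x n) (n + 1)) ∂μ ≤
      ENNReal.ofReal (energy c w x (x n) n) * μ (history X x n) := by
  have hw : ∀ n, 0 < w n := fun n => hc.trans_le (hcw n)
  have hr : 0 < w (visits x n (x n + 1)) := hw _
  have hR : MeasurableSet {ω | X (n + 1) ω = x n + 1} :=
    hX.measurable (n + 1) (measurableSet_singleton _)
  set p := rightProb w x n (x n)
  set t := c / (2 * w (visits x n (x n + 1))) with ht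
  set v := energy c w x (x n) n
  have hp0 : 0 ≤ p := rightProb_nonneg hw
  have hp1 : 0 ≤ 1 - p := sub_nonneg.2 (rightProb_le_one hw)
  have hv0 : 0 < v := exp_pos _
  have ht0 : 0 ≤ t := by positivity
  have ht_half : t ≤ 1 / 2 := by
    rw [ht, div_le_div_iff₀ (by positivity) two_pos]
    linarith [hcw (visits x n (x n + 1))]
  have hright : ∀ ω ∈ history X x n ∩ {ω | X (n + 1) ω = x n + 1},
      ENNReal.ofReal (energy c w (fun k => X k ω) (x n) (n + 1)) =
        ENNReal.ofReal (v * (exp (p * t) * exp (-(2 * t)))) := fun ω ⟨hω, hωR⟩ => by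
    have hjump : X (n + 1) ω = x n + 1 := hωR
    rw [energy_succ_of_eq_add_one hw (hω n le_rfl) hjump, energy_congr hω, rightProb_congr hω,
      visits_congr hω]
  have hleft : ∀ ω ∈ history X x n \ {ω | X (n + 1) ω = x n + 1},
      ENNReal.ofReal (energy c w (fun k => X k ω) (x n) (n + 1)) =
        ENNReal.ofReal (v * exp (p * t)) := fun ω ⟨hω, hωR⟩ => by
    have hjump : X (n + 1) ω ≠ x n + 1 := hωR
    rw [energy_succ_of_ne_add_one hw (hω n le_rfl) hjump, energy_congr hω, rightProb_congr hω,
      visits_congr hω]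
  rw [setLIntegral_eq_of_eq_inter_of_eq_sdiff (measurableSet_history hX.measurable x n) hR hright
    hleft, hX.measure_history_inter_right, hX.measure_history_sdiff_right hw,
    ← mul_assoc (ENNReal.ofReal (v * (exp (p * t) * exp (-(2 * t))))),
    ← mul_assoc (ENNReal.ofReal (v * exp (p * t))), ← add_mul,
    ← ENNReal.ofReal_mul (by positivity), ← ENNReal.ofReal_mul (by positivity),
    ← ENNReal.ofReal_add (by positivity) (by positivity)]
  gcongr
  calc v * (exp (p * t) * exp (-(2 * t))) * p + v * exp (p * t) * (1 - p)
      = v * (exp (p * t) * (p * exp (-(2 * t)) + (1 - p))) := by ring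
    _ ≤ v := mul_le_of_le_one_right hv0.le (exp_mul_average_le_one hp0 ht0 ht_half)

theorem setLIntegral_energy_succ_le [IsFiniteMeasure μ] (hX : IsVRRW w X μ) (hc : 0 < c)
    (hcw : ∀ n, c ≤ w n) (y : ℤ) (n : ℕ) (x : ℕ → ℤ) :
    ∫⁻ ω in history X x n, ENNReal.ofReal (energy c w (fun k => X k ω) y (n + 1)) ∂μ ≤
      ∫⁻ ω in history X x n, ENNReal.ofReal (energy c w (fun k => X k ω) y n) ∂μ := by
  have hS := measurableSet_history hX.measurable x n
  rcases eq_or_ne (x n) y with rfl | hxy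
  · refine (hX.setLIntegral_energy_apply_succ_le hc hcw x n).trans_eq ?_
    rw [← setLIntegral_const]
    exact setLIntegral_congr_fun hS fun ω hω => by rw [energy_congr hω]
  · refine setLIntegral_mono' hS fun ω hω => ENNReal.ofReal_le_ofReal ?_
    exact energy_succ_le_of_ne hc.le (fun n => hc.le.trans (hcw n))
      ((hω n le_rfl).trans_ne hxy)

theorem lintegral_energy_le_one [IsProbabilityMeasure μ] (hX : IsVRRW w X μ) (hc : 0 < c)
    (hcw : ∀ n, c ≤ w n) (y : ℤ) (n : ℕ) :
    ∫⁻ ω, ENNReal.ofReal (energy c w (fun k => X k ω) y n) ∂μ ≤ 1 := by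
  induction n with
  | zero =>
    refine (lintegral_mono fun ω => ENNReal.ofReal_le_one.2
      (energy_zero_le_one hc.le fun n => hc.le.trans (hcw n))).trans_eq ?_
    rw [lintegral_one, measure_univ]
  | succ n ih =>
    exact (lintegral_le_of_setLIntegral_history_le hX.measurable n
      (hX.setLIntegral_energy_succ_le hc hcw y n)).trans ih

theorem ae_frequently_energy_le [IsProbabilityMeasure μ] (hX : IsVRRW w X μ) (hc : 0 < c)
    (hcw : ∀ n, c ≤ w n) (I : Finset ℤ) :
    ∀ᵐ ω ∂μ, ∃ K : ℝ, ∃ᶠ n in atTop, ∀ y ∈ I, energy c w (fun k => X k ω) y n ≤ K := by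
  have hmeas : ∀ y n, Measurable fun ω => ENNReal.ofReal (energy c w (fun k => X k ω) y n) :=
    fun y n => (measurable_energy hX.measurable y n).ennreal_ofReal
  have hsum : ∀ n, ∫⁻ ω, ∑ y ∈ I, ENNReal.ofReal (energy c w (fun k => X k ω) y n) ∂μ ≤
      I.card := fun n => by
    rw [lintegral_finsetSum _ fun y _ => hmeas y n]
    exact (Finset.sum_le_card_nsmul I _ 1 fun y _ =>
      hX.lintegral_energy_le_one hc hcw y n).trans_eq (nsmul_one _)
  filter_upwards [ae_exists_frequently_le_of_lintegral_le
    (fun n => Finset.measurable_sum I fun y _ => hmeas y n) (ENNReal.natCast_ne_top _) hsum]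
    with ω ⟨K, hK, hfreq⟩
  refine ⟨K.toReal, hfreq.mono fun n hn y hy => ?_⟩
  rw [← ENNReal.ofReal_le_iff_le_toReal hK]
  exact (Finset.single_le_sum_of_canonicallyOrdered hy).trans hn

end IsVRRW

end Walk

/-! ### Propagation from a site to the next -/

section Localization

theorem IsWeightFunction.monotone_natCast {w : ℝ → ℝ} (hw : IsWeightFunction w) :
    Monotone fun n : ℕ => w n := fun m n hmn =>
  hw.monotoneOn (mem_Ici.2 m.cast_nonneg) (mem_Ici.2 n.cast_nonneg) (Nat.cast_le.2 hmn)

theorem IsWeightFunction.map_zero_le_natCast {w : ℝ → ℝ} (hw : IsWeightFunction w) (n : ℕ) :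
    w 0 ≤ w n :=
  hw.monotoneOn self_mem_Ici (mem_Ici.2 n.cast_nonneg) n.cast_nonneg

theorem IsWeightFunction.invSum_le {w : ℝ → ℝ} (hw : IsWeightFunction w) (z : ℕ) :
    invSum (fun n => w n) z ≤ 1 / w 0 + W w z := by
  have hsucc : invSum (fun n => w n) (z + 1) ≤ 1 / w 0 + W w z := by
    induction z with
    | zero => simp [invSum, W_zero]
    | succ z ih =>
      have hstep := hw.sub_div_le_W_sub_W z.cast_nonneg (Nat.cast_le.2 z.le_succ)
      rw [Nat.cast_succ, add_sub_cancel_left] at hstep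
      rw [invSum, Finset.sum_range_succ, ← invSum, Nat.cast_succ]
      linarith
  refine le_trans ?_ hsucc
  rw [invSum, invSum, Finset.sum_range_succ]
  exact le_add_of_nonneg_right (one_div_nonneg.2 (hw.pos z z.cast_nonneg).le)

theorem visits_sub_one_div_le_drift {w : ℕ → ℝ} (hw : ∀ n, 0 < w n) (hmono : Monotone w)
    (x : ℕ → ℤ) (n : ℕ) (y : ℤ) : ((visits x n y : ℝ) - 1) / (2 * w n) ≤ drift w x y n := by
  have hcard : (visits x n y : ℝ) - 1 ≤ ((Finset.range n).filter fun k => x k = y).card := by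
    rw [sub_le_iff_le_add, visits, Finset.range_add_one, Finset.filter_insert]
    split_ifs
    · exact_mod_cast Finset.card_insert_le _ _
    · exact_mod_cast Nat.le_succ _
  have hweight : ∀ k < n, ∀ z, w (visits x k z) ≤ w n := fun k hk z =>
    hmono ((visits_le x k z).trans hk)
  have hsum := Finset.card_nsmul_le_sum ((Finset.range n).filter fun k => x k = y)
    (fun k => 1 / (w (visits x k (y - 1)) + w (visits x k (y + 1)))) (1 / (2 * w n))
    fun k hk => by
      have hkn := Finset.mem_range.1 (Finset.mem_filter.1 hk).1
      refine one_div_le_one_div_of_le (add_pos (hw _) (hw _)) ?_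
      linarith [hweight k hkn (y - 1), hweight k hkn (y + 1)]
  rw [drift, ← Finset.sum_filter]
  refine le_trans ?_ hsum
  rw [nsmul_eq_mul, mul_one_div]
  exact div_le_div_of_nonneg_right hcard (mul_pos two_pos (hw n)).le

theorem IsWeightFunction.exists_visits_div_le_of_energy_le {w : ℝ → ℝ} (hw : IsWeightFunction w)
    (K : ℝ) : ∃ C, ∀ x y n, energy (w 0) (fun n => w n) x y n ≤ K →
      visits x n y / w n ≤ 4 * W w (visits x n (y + 1)) + C := by
  have hw0 : 0 < w 0 := hw.pos 0 le_rfl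
  refine ⟨(4 * log K + 5) / w 0, fun x y n hK => ?_⟩
  have hwn : 0 < w n := hw.pos n n.cast_nonneg
  have hinv : 1 / w n ≤ 1 / w 0 := one_div_le_one_div_of_le hw0 (hw.map_zero_le_natCast n)
  have hlog : drift (fun n => w n) x y n / 2 - invSum (fun n => w n) (visits x n (y + 1)) ≤
      log K / w 0 := by
    rw [le_div_iff₀' hw0]
    exact (le_log_iff_exp_le ((exp_pos _).trans_le hK)).2 hK
  have hdrift := visits_sub_one_div_le_drift (fun n => hw.pos n n.cast_nonneg)
    hw.monotone_natCast x n y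
  have hsum := hw.invSum_le (visits x n (y + 1))
  have hsplit : (visits x n y : ℝ) / w n =
      2 * (((visits x n y : ℝ) - 1) / (2 * w n)) + 1 / w n := by
    field_simp
    ring
  have hconst : (4 * log K + 5) / w 0 = 4 * (log K / w 0) + 5 * (1 / w 0) := by ring
  linarith

/-- The path `x` spends at `y`, along `l`, a proportion of its time `n` that is at least
`exp (-(log n) ^ b)` for some `b < 1`. -/
def HeavySite (l : Filter ℕ) (x : ℕ → ℤ) (y : ℤ) : Prop :=
  SlowDecay l (fun n => log n) fun n => visits x n y / n

namespace HeavySite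

variable {l : Filter ℕ} {x : ℕ → ℤ} {y : ℤ}

theorem mem_range [l.NeBot] (h : HeavySite l x y) : y ∈ Set.range x := by
  obtain ⟨n, hn⟩ := h.eventually_pos.exists
  have hvisits : visits x n y ≠ 0 := fun hzero => by simp [hzero] at hn
  obtain ⟨k, hk⟩ := Finset.card_ne_zero.1 hvisits
  exact ⟨k, (Finset.mem_filter.1 hk).2⟩

theorem of_mul_le_visits (hl : l ≤ atTop) {c : ℝ} (hc : 0 < c)
    (h : ∀ᶠ n in l, c * n ≤ visits x n y) : HeavySite l x y := by
  have hlog : Tendsto (fun n : ℕ => log n) l atTop :=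
    (tendsto_log_atTop.comp tendsto_natCast_atTop_atTop).mono_left hl
  refine (SlowDecay.const hlog hc).mono ?_
  filter_upwards [h, hl (eventually_gt_atTop 0)] with n hn hn0
  rwa [le_div_iff₀ (Nat.cast_pos.2 hn0)]

theorem add_one {w : ℝ → ℝ} (h : HeavySite l x y) (hs : UniformlySublinear w)
    (hw : IsWeightFunction w) (hl : l ≤ atTop) {K : ℝ}
    (hK : ∀ᶠ n : ℕ in l, energy (w 0) (fun n => w n) x y n ≤ K) : HeavySite l x (y + 1) := by
  have hn : Tendsto (fun n : ℕ => (n : ℝ)) l atTop := tendsto_natCast_atTop_atTop.mono_left hl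
  have hlog := tendsto_log_atTop.comp hn
  obtain ⟨C, hC⟩ := hw.exists_visits_div_le_of_energy_le K
  have htop : Tendsto (fun n : ℕ => (visits x n y : ℝ) / w n) l atTop := by
    refine (h.tendsto_mul_atTop hlog fun c hc =>
      hn.eventually (hs.eventually_exp_rpow_le_div hw hc)).congr' ?_
    filter_upwards [hn.eventually_ne_atTop 0] with n hn0
    field_simp
  refine hs.slowDecay_div hw hn (.of_forall fun n => Nat.cast_nonneg _)
    ((h.const_mul hlog (c := 1 / 8) (by norm_num)).mono ?_)
  filter_upwards [hK, htop.eventually_ge_atTop (2 * C), hn.eventually_gt_atTop 0]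
    with n hKn hCn hn0
  have hwn : 0 < w n := hw.pos n hn0.le
  calc 1 / 8 * ((visits x n y : ℝ) / n) = 1 / 8 * (visits x n y / w n) / (n / w n) := by
        field_simp
    _ ≤ W w (visits x n (y + 1)) / (n / w n) := by
        gcongr
        linarith [hC x y n hKn]

end HeavySite

theorem exists_inv_card_mul_le_visits {x : ℕ → ℤ} {I : Finset ℤ} (hI : ∀ n, x n ∈ I) (n : ℕ) :
    ∃ y ∈ I, (I.card : ℝ)⁻¹ * n ≤ visits x n y := by
  have hne : I.Nonempty := ⟨x 0, hI 0⟩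
  refine Finset.exists_le_card_fiber_of_nsmul_le_card_of_maps_to (fun k _ => hI k) hne ?_
  rw [nsmul_eq_mul, mul_inv_cancel_left₀ (Nat.cast_ne_zero.2 hne.card_ne_zero), Finset.card_range]
  exact Nat.cast_le.2 n.le_succ

theorem not_localizes_of_frequently_energy_le {w : ℝ → ℝ} (hs : UniformlySublinear w)
    (hw : IsWeightFunction w) {x : ℕ → ℤ}
    (h : ∀ I : Finset ℤ, ∃ K : ℝ, ∃ᶠ n in atTop, ∀ y ∈ I, energy (w 0) (fun n => w n) x y n ≤ K) :
    ¬ Localizes x := by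
  intro hfin
  set I := hfin.toFinset
  have hI : ∀ {y}, y ∈ I ↔ y ∈ Set.range x := hfin.mem_toFinset
  have hcard : 0 < (I.card : ℝ)⁻¹ :=
    inv_pos.2 (Nat.cast_pos.2 (Finset.card_pos.2 ⟨x 0, hI.2 ⟨0, rfl⟩⟩))
  obtain ⟨K, hK⟩ := h I
  obtain ⟨y₀, -, hy₀⟩ : ∃ y₀ ∈ I, ∃ᶠ n in atTop,
      (∀ y ∈ I, energy (w 0) (fun n => w n) x y n ≤ K) ∧ (I.card : ℝ)⁻¹ * n ≤ visits x n y₀ :=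
    (frequently_exists_finset I).1 (hK.mono fun n hn =>
      (exists_inv_card_mul_le_visits (fun k => hI.2 ⟨k, rfl⟩) n).imp fun y hy => ⟨hy.1, hn, hy.2⟩)
  obtain ⟨l, hl, hlne, hlK, hly₀⟩ : ∃ l ≤ atTop, l.NeBot ∧
      (∀ᶠ n in l, ∀ y ∈ I, energy (w 0) (fun n => w n) x y n ≤ K) ∧
      ∀ᶠ n in l, (I.card : ℝ)⁻¹ * n ≤ visits x n y₀ :=
    ⟨_, inf_le_left, frequently_mem_iff_neBot.1 hy₀,
      eventually_and.1 (mem_inf_of_right (mem_principal_self _))⟩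
  have hsub : {y | HeavySite l x y} ⊆ Set.range x := fun y hy => HeavySite.mem_range hy
  obtain ⟨y, hy, hmax⟩ := Set.exists_max_image _ id (hfin.subset hsub)
    ⟨y₀, HeavySite.of_mul_le_visits hl hcard hly₀⟩
  have hstep : HeavySite l x (y + 1) :=
    HeavySite.add_one hy hs hw hl (hlK.mono fun n hn => hn y (hI.2 (hsub hy)))
  exact (hmax (y + 1) hstep).not_gt (lt_add_one y)

theorem IsVRRW.ae_not_localizes {w : ℝ → ℝ} (hs : UniformlySublinear w) (hw : IsWeightFunction w)
    {Ω : Type*} [MeasurableSpace Ω] {μ : Measure Ω} [IsProbabilityMeasure μ] {X : ℕ → Ω → ℤ}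
    (hX : IsVRRW (fun n => w n) X μ) : ∀ᵐ ω ∂μ, ¬ Localizes fun n => X n ω := by
  have henergy := ae_all_iff.2 fun I : Finset ℤ =>
    hX.ae_frequently_energy_le (hw.pos 0 le_rfl) hw.map_zero_le_natCast I
  filter_upwards [henergy] with ω hω using not_localizes_of_frequently_energy_le hs hw hω

end Localization

end VRRW

theorem mainTheorem4_general (w : ℝ → ℝ) (hw : VRRW.IsWeightFunction w)
    (hs : VRRW.UniformlySublinear w) :
    (∀ η : ℝ, 0 < η → VRRW.index w η = ⊤) ∧
    (∀ {Ω : Type*} [MeasurableSpace Ω] (μ : Measure Ω) [IsProbabilityMeasure μ] (X : ℕ → Ω → ℤ),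
      VRRW.IsVRRW (fun n : ℕ => w n) X μ →
        ∀ᵐ ω ∂μ, ¬ VRRW.Localizes (fun n => X n ω)) ∧
    (∀ α : ℝ, α < 1 →
      w =o[atTop] fun x : ℝ => x / Real.exp ((Real.log x) ^ α)) :=
  ⟨fun _ hη => hs.index_eq_top hw hη, fun _ _ _ hX => hX.ae_not_localizes hs hw,
    fun _ hα => hs.isLittleO_div_exp hw hα⟩

theorem mainTheorem4 (w : ℝ → ℝ) (hw : VRRW.IsWeightFunction w)
    (hlarge : ∀ᶠ x : ℝ in atTop,
      w x = x * Real.exp (-(Real.log x / Real.log (Real.log x)))) :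
    -- `i_-(w) = i_+(w) = +∞`
    (Tendsto (fun η : ℝ => VRRW.index w η) (𝓝[<] (1 / 2 : ℝ)) (𝓝 (⊤ : ℕ∞)) ∧
      Tendsto (fun η : ℝ => VRRW.index w η) (𝓝[>] (1 / 2 : ℝ)) (𝓝 (⊤ : ℕ∞))) ∧
    -- every walk with the weight sequence `(w(n))` almost surely does not localize
    (∀ {Ω : Type*} [MeasurableSpace Ω] (μ : Measure Ω) [IsProbabilityMeasure μ] (X : ℕ → Ω → ℤ),
      VRRW.IsVRRW (fun n : ℕ => w n) X μ →
        ∀ᵐ ω ∂μ, ¬ VRRW.Localizes (fun n => X n ω)) ∧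
    -- `w` grows slower than `x / exp(log^α x)` for every `α < 1`
    (∀ α : ℝ, α < 1 →
      w =o[atTop] fun x : ℝ => x / Real.exp ((Real.log x) ^ α)) := by
  obtain ⟨hindex, hwalk, hlittle⟩ :=
    mainTheorem4_general w hw (VRRW.uniformlySublinear_of_eventually_eq_mul_exp hlarge)
  have htop : ∀ᶠ η in 𝓝 (1 / 2 : ℝ), VRRW.index w η = ⊤ :=
    (eventually_gt_nhds one_half_pos).mono hindex
  exact ⟨⟨tendsto_nhds_of_eventually_eq (htop.filter_mono nhdsWithin_le_nhds),
    tendsto_nhds_of_eventually_eq (htop.filter_mono nhdsWithin_le_nhds)⟩, hwalk, hlittle⟩
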